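/- **Setting.** A labeled graph is a pair $(G,\ell)$ of a finite simple graph $G=(V,E)$ with $|V|\ge 1$ and a function $\ell:V\to\{0,1\}^*$ (the blank label $\bot$ is the empty string); a distributed language is a set of labeled graphs. Fix $N:\mathbb N\to\mathbb N$ with $n\le N(n)$ for all $n$ and $N(n)=\mathrm{poly}(n)$. In an $n$-node graph the nodes carry arbitrary distinct identifiers in $[1,N(n)]$; each node initially knows $n$, its identifier, its label and the identifiers of its neighbors. All nodes run the same algorithm, local computation is unrestricted, and computation proceeds in synchronous rounds. In a LOCAL round each node sends to each neighbor a bit string of arbitrary length; in a CONGEST round it sends to each neighbor a (possibly different) string of $O(\log n)$ bits; in a BCC round it sends one string of $O(\log n)$ bits to all other nodes of the network. At the end each node accepts or rejects. A deterministic algorithm decides $\mathcal L$ if for every labeled graph and every identifier assignment: $(G,\ell)\in\mathcal L$ if and only if all nodes accept. A randomized algorithm (nodes may share random coins) decides $\mathcal L$ with error $\delta$ if for every labeled graph and every identifier assignment this equivalence fails with probability at most $\delta$. Let $\mathbf{LL},\mathbf{BB},\mathbf{LB},\mathbf{CC}$ be the classes of languages decided by deterministic algorithms performing, respectively, two LOCAL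 rounds; two BCC rounds; one LOCAL round and then one BCC round; two CONGEST rounds. Let $\mathcal P$ be the set of labeled paths $(P,\ell)$ with $P=u_n,\dots,u_1,v_1,\dots,v_n$ a path on $2n$ nodes, $n>2$, $\ell(u_2),\ell(v_2)\in\{0,1\}^n$ and $\ell(w)=\bot$ for all $w\notin\{u_2,v_2\}$ (so the two inputs are at distance $3$). Let disjointness-on-path be the set of $(P,\ell)\in\mathcal P$ with $\mathrm{DISJ}(\ell(u_2),\ell(v_2))=1$, that is, such that no index $i\in[n]$ has $\ell(u_2)_i=\ell(v_2)_i=1$. **Theorem.** $\mathbf{LL}\smallsetminus(\mathbf{BB}\cup\mathbf{LB}\cup\mathbf{CC})\neq\varnothing$. More precisely: 1. there is a language $\mathcal L\in\mathbf{LL}\smallsetminus(\mathbf{BB}\cup\mathbf{LB}\cup\mathbf{CC})$ that coincides with disjointness-on-path on $\mathcal P$, i.e. $\mathcal L\cap\mathcal P=\text{disjointness-on-path}$; 2. for every language $\mathcal L$ with $\mathcal L\cap\mathcal P=\text{disjointness-on-path}$ (in particular for the language of part 1 and for disjointness-on-path itself) and every $\varepsilon>0$, no randomized algorithm performing two BCC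 rounds, or one LOCAL round and then one BCC round, or two CONGEST rounds, decides $\mathcal L$ with error probability at most $\frac12-\varepsilon$. -/

import Mathlib

open MeasureTheory

noncomputable section

namespace HybridModels

/-! ## Labeled graphs and distributed languages -/

/-- A finite simple graph on at least one vertex, together with a label in `{0,1}^*` on each vertex.
The graph need not be connected.  The empty string plays the role of the blank label `⊥`. -/
structure LabeledGraph where
  n : ℕ
  n_pos : 0 < n
  graph : SimpleGraph (Fin n)
  label : Fin n → List Bool

/-- A distributed language: a collection of labeled graphs. -/
abbrev DistLanguage := Set LabeledGraph

/-- One-to-one assignments of identifiers in `[1, N n]` to the vertices of an `n`-vertex graph. -/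
def IsIdAssignment (N : ℕ → ℕ) (I : LabeledGraph) (id : Fin I.n → ℕ) : Prop :=
  Function.Injective id ∧ ∀ v, 1 ≤ id v ∧ id v ≤ N I.n

/-! ## Hybrid algorithms -/

/-- The three kinds of synchronous communication rounds. -/
inductive RoundKind where
  | LOCAL
  | CONGEST
  | BCC

/-- What a node knows before any communication: the size of the network, its own identifier, the
identifiers of its neighbors, and its own label. -/
structure NodeInput where
  size : ℕ
  self : ℕ
  nbrs : Finset ℕ
  label : List Bool

/-- What a node receives in one round: pairs (identifier of the sender, message). -/
abbrev Reception := Finset (ℕ × List Bool)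

/-- A deterministic algorithm, run by every node.  Each action of a node is a function of its initial
knowledge and of everything that it has received so far (one `Reception` for each past round, in
chronological order; in particular the node knows the index of the current round).  Local computation
is not restricted.
* `send inp hist t`: the message sent to the neighbor with identifier `t` in a LOCAL or CONGEST round;
* `bcast inp hist`: the message sent to all other nodes in a BCC round;
* `output inp hist`: the final verdict, `true` for accept. -/
structure Algorithm where
  send : NodeInput → List Reception → ℕ → List Bool
  bcast : NodeInput → List Reception → List Bool
  output : NodeInput → List Reception → Bool

open Classical in
/-- The initial knowledge of the node `v`. -/
def nodeInput (I : LabeledGraph) (id : Fin I.n → ℕ) (v : Fin I.n) : NodeInput where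
  size := I.n
  self := id v
  nbrs := (Finset.univ.filter fun w => I.graph.Adj v w).image id
  label := I.label v

open Classical in
/-- What the node `v` receives in a round of kind `k`, given the histories `h` of all nodes before
that round: from each neighbor the message addressed to `v` if the round is LOCAL or CONGEST,
from each other node of the network its broadcast message if the round is BCC. -/
def received (A : Algorithm) (I : LabeledGraph) (id : Fin I.n → ℕ) (k : RoundKind)
    (h : Fin I.n → List Reception) (v : Fin I.n) : Reception :=
  match k with
  | .LOCAL | .CONGEST =>
      (Finset.univ.filter fun w => I.graph.Adj v w).image
        fun w => (id w, A.send (nodeInput I id w) (h w) (id v))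
  | .BCC =>
      (Finset.univ.filter fun w => w ≠ v).image
        fun w => (id w, A.bcast (nodeInput I id w) (h w))

/-- The histories of all nodes after the rounds listed in `rs` have been performed, in this order. -/
def run (A : Algorithm) (rs : List RoundKind) (I : LabeledGraph) (id : Fin I.n → ℕ) :
    Fin I.n → List Reception :=
  rs.foldl (fun h k v => h v ++ [received A I id k h v]) fun _ => []

/-- All nodes accept at the end of the execution. -/
def AllAccept (A : Algorithm) (rs : List RoundKind) (I : LabeledGraph) (id : Fin I.n → ℕ) : Prop :=
  ∀ v, A.output (nodeInput I id v) (run A rs I id v) = true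

/-- Messages of CONGEST and BCC rounds have at most `c * (⌊log₂ n⌋ + 1)` bits in `n`-node networks.
There is no such restriction on LOCAL rounds. -/
def RespectsBandwidth (A : Algorithm) (rs : List RoundKind) (c : ℕ) : Prop :=
  ∀ (inp : NodeInput) (hist : List Reception),
    (rs[hist.length]? = some .CONGEST →
      ∀ t, (A.send inp hist t).length ≤ c * (Nat.log 2 inp.size + 1)) ∧
    (rs[hist.length]? = some .BCC →
      (A.bcast inp hist).length ≤ c * (Nat.log 2 inp.size + 1))

/-- The class of languages decided by a deterministic algorithm performing the rounds `rs`, with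
identifiers in `[1, N n]`, and with messages of `O(log n)` bits in CONGEST and BCC rounds. -/
def hybridClass (N : ℕ → ℕ) (rs : List RoundKind) : Set DistLanguage :=
  {𝓛 | ∃ (A : Algorithm) (c : ℕ), RespectsBandwidth A rs c ∧
    ∀ (I : LabeledGraph) (id : Fin I.n → ℕ), IsIdAssignment N I id →
      (AllAccept A rs I id ↔ I ∈ 𝓛)}

/-- The class of languages decided with error probability at most `δ` by a randomized algorithm
performing the rounds `rs`.  A randomized algorithm is a random deterministic algorithm; the random
source `Ω` may be used by all nodes, which covers shared coins as well as private coins (a node can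
restrict itself to a component of `Ω` that is indexed by its identifier). -/
def randHybridClass (N : ℕ → ℕ) (rs : List RoundKind) (δ : ℝ) : Set DistLanguage :=
  {𝓛 | ∃ (Ω : Type) (_ : MeasurableSpace Ω) (μ : Measure Ω) (_ : IsProbabilityMeasure μ)
      (A : Ω → Algorithm) (c : ℕ), (∀ ω, RespectsBandwidth (A ω) rs c) ∧
    ∀ (I : LabeledGraph) (id : Fin I.n → ℕ), IsIdAssignment N I id →
      MeasurableSet {ω | AllAccept (A ω) rs I id} ∧
      μ.real {ω | ¬ (AllAccept (A ω) rs I id ↔ I ∈ 𝓛)} ≤ δ}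

/-! ## Disjointness on paths -/

/-- `DISJ(x, y) = 1`: no index `i` has `x i = y i = 1`. -/
def Disj {n : ℕ} (x y : Fin n → Bool) : Prop := ∀ i, ¬ (x i = true ∧ y i = true)

/-- `I` is a path `u_n, …, u_1, v_1, …, v_n` on `2 * n` vertices, `n > 2`, where `u_2` is labeled `x`,
`v_2` is labeled `y`, and all other vertices are blank.  The `j`-th vertex of the path, counted
from `0`, is `e j`; so `u_i` is vertex number `n - i` and `v_i` is vertex number `n + i - 1`. -/
def IsDisjPath (I : LabeledGraph) (n : ℕ) (x y : Fin n → Bool) : Prop :=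
  2 < n ∧ ∃ e : SimpleGraph.pathGraph (2 * n) ≃g I.graph, ∀ j : Fin (2 * n),
    I.label (e j) =
      if (j : ℕ) = n - 2 then List.ofFn x
      else if (j : ℕ) = n + 1 then List.ofFn y
      else []

/-- The instances: all paths as above, for all `n > 2` and all `x, y ∈ {0,1}^n`. -/
def disjPaths : Set LabeledGraph :=
  {I | ∃ (n : ℕ) (x y : Fin n → Bool), IsDisjPath I n x y}

/-- The language `disjointness-on-path`: the paths as above with `DISJ(x, y) = 1`. -/
def disjointnessOnPath : DistLanguage :=
  {I | ∃ (n : ℕ) (x y : Fin n → Bool), IsDisjPath I n x y ∧ Disj x y}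

end HybridModels

end

/-! The upper bound is witnessed by `disjointOnWalks`. After two LOCAL rounds the second vertex of a
walk of length 3 knows the labels of both ends. On the paths in question such a walk has distinct
ends by parity, and a clash can only involve `u_2` and `v_2`.

For the lower bounds, cut the path between `u_1` and `v_1`. The inputs are at distance 3, so in each
of the three models at most six messages of `O(log n)` bits determine what each half learns about
the other. For fixed coins, the accepted inputs with a given transcript therefore form a rectangle
(`Splices`), and there are only polynomially many transcripts.

What remains is a corruption bound for disjointness. Let `x` be the zero set of a uniform word `z`
over an alphabet of size `q = 2k`, and `y` the set of entries of a uniform `k`-tuple of coordinates;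
such a pair is disjoint with probability at least 1/2. By `card_rectangle_le` a fraction of at least
`1/(2q)` of every rectangle is intersecting, up to an additive error which is `O(n⁻ᵏ)` of all pairs
for fixed `k`. Thus the weight `1 - 2q·[intersecting]` has a small sum on every rectangle.

An arbitrarily small gap `b < a` in acceptance probabilities is amplified by their `j`-th powers, at
a cost of `|T|^j` (`sum_mul_pow_le`). With `|T| ≤ n^C` and `k = Cj + 1`, the error term still tends
to zero as `n` grows, which contradicts the gap (`exists_size_no_protocol`). -/

/-! ### Corruption bound for sparse disjointness -/

theorem card_filter_apply_eq_zero {n q : ℕ} [NeZero q] (i : Fin n) :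
    q * (Finset.univ.filter fun z : Fin n → Fin q => z i = 0).card = q ^ n := by
  have h := Fintype.card_filter_piFinset_const_eq_of_mem (Finset.univ : Finset (Fin q)) i
    (Finset.mem_univ 0)
  rw [Fintype.piFinset_univ] at h
  rw [h]
  have : 0 < n := i.pos
  simp [← pow_succ', Nat.sub_add_cancel this]

/-- Union bound: each of the `k` queried coordinates is zero with probability `1/(2k)`. -/
theorem half_le_card_disjoint {n k : ℕ} [NeZero (2 * k)] (y : Fin k → Fin n) :
    (2 * k) ^ n ≤
      2 * (Finset.univ.filter fun z : Fin n → Fin (2 * k) => ∀ j, z (y j) ≠ 0).card := by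
  have h1 : (Finset.univ.filter fun z : Fin n → Fin (2 * k) => ∃ j, z (y j) = 0).card
      ≤ ∑ j, (Finset.univ.filter fun z : Fin n → Fin (2 * k) => z (y j) = 0).card := by
    have : (Finset.univ.filter fun z : Fin n → Fin (2 * k) => ∃ j, z (y j) = 0) =
        Finset.univ.biUnion fun j => Finset.univ.filter fun z => z (y j) = 0 := by
      ext; simp
    rw [this]
    exact Finset.card_biUnion_le
  have h2 : 2 * k * ∑ j, (Finset.univ.filter fun z : Fin n → Fin (2 * k) => z (y j) = 0).card
      = k * (2 * k) ^ n := by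
    simp [Finset.mul_sum, card_filter_apply_eq_zero]
  have h3 := Finset.card_filter_add_card_filter_not (s := Finset.univ)
    fun z : Fin n → Fin (2 * k) => ∃ j, z (y j) = 0
  simp only [Finset.card_univ, Fintype.card_pi, Fintype.card_fin, Finset.prod_const,
    not_exists] at h3
  have hk : 0 < k := by
    have := NeZero.ne (2 * k)
    omega
  have h4 : 2 * ∑ j, (Finset.univ.filter fun z : Fin n → Fin (2 * k) => z (y j) = 0).card
      = (2 * k) ^ n := by
    apply Nat.eq_of_mul_eq_mul_left hk
    rw [← h2]; ring
  simp only [ne_eq]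
  omega

/-- The Laplace transform of the number of zeros in `D` of a uniformly random word. -/
theorem sum_exp_neg_card_zeros {n q : ℕ} [NeZero q] (D : Finset (Fin n)) :
    ∑ z : Fin n → Fin q, Real.exp (-((D.filter fun i => z i = 0).card : ℝ)) ≤
      (q : ℝ) ^ n * Real.exp (-(6 / 10) * D.card / q) := by
  have hq : (0 : ℝ) < q := by exact_mod_cast Nat.pos_of_ne_zero (NeZero.ne q)
  have h1 : ∀ z : Fin n → Fin q, Real.exp (-((D.filter fun i => z i = 0).card : ℝ)) =
      ∏ i, (if i ∈ D ∧ z i = 0 then Real.exp (-1) else 1) := by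
    intro z
    rw [Finset.prod_ite]
    simp only [Finset.prod_const, one_pow, mul_one]
    rw [← Real.exp_nat_mul, mul_neg_one]
    congr 4
    ext; simp
  have h2 : ∀ i, ∑ a : Fin q, (if i ∈ D ∧ a = 0 then Real.exp (-1) else 1) ≤
      q * (if i ∈ D then Real.exp (-(6 / 10) / q) else 1) := by
    intro i
    by_cases hi : i ∈ D
    · simp only [hi, true_and, if_true]
      have : ∀ a : Fin q, (if a = 0 then Real.exp (-1) else 1) =
          1 - (if a = 0 then 1 - Real.exp (-1) else 0) := by
        intro a; split_ifs <;> ring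
      simp only [this, Finset.sum_sub_distrib]
      simp only [Finset.sum_const, Finset.card_univ, Fintype.card_fin, Finset.sum_ite_eq',
        Finset.mem_univ, if_true, nsmul_eq_mul, mul_one]
      have h3 := Real.add_one_le_exp (-(6 / 10) / (q : ℝ))
      -- The resulting constant `1 - e⁻¹ ≥ 6/10` must exceed the 1/2 coming from rarity in
      -- `card_le_of_rare_zeros`; the difference is the 1/10 there.
      have h4 : Real.exp (-1) ≤ 4 / 10 := by
        have := Real.exp_neg_one_lt_d9
        linarith
      calc (q : ℝ) - (1 - Real.exp (-1)) ≤ q * (-(6 / 10) / q + 1) := by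
            field_simp; linarith
        _ ≤ _ := by gcongr
    · simp [hi]
  calc ∑ z : Fin n → Fin q, Real.exp (-((D.filter fun i => z i = 0).card : ℝ))
      = ∏ i, ∑ a : Fin q, (if i ∈ D ∧ a = 0 then Real.exp (-1) else 1) := by
        simp only [h1]
        rw [Finset.prod_univ_sum, Fintype.piFinset_univ]
    _ ≤ ∏ i, (q * (if i ∈ D then Real.exp (-(6 / 10) / q) else 1)) := by
        apply Finset.prod_le_prod
        · intro i _
          apply Finset.sum_nonneg
          intro a _
          split_ifs <;> positivity
        · intro i _; exact h2 i
    _ = (q : ℝ) ^ n * Real.exp (-(6 / 10) * D.card / q) := by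
        rw [Finset.prod_mul_distrib, Finset.prod_ite_mem]
        simp only [Finset.prod_const, Finset.univ_inter, Finset.card_univ, Fintype.card_fin]
        rw [← Real.exp_nat_mul]
        congr 2
        ring

/-- If the symbol `0` is rare in `A` at every coordinate of `D`, then `A` is exponentially small. -/
theorem card_le_of_rare_zeros {n q : ℕ} [NeZero q] (A : Finset (Fin n → Fin q))
    (D : Finset (Fin n)) (hD : ∀ i ∈ D, 2 * q * (A.filter fun z => z i = 0).card ≤ A.card) :
    (A.card : ℝ) ≤ (q : ℝ) ^ n * Real.exp (-(D.card / (10 * q))) := by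
  have hq : (0 : ℝ) < q := by exact_mod_cast Nat.pos_of_ne_zero (NeZero.ne q)
  set s : (Fin n → Fin q) → ℝ := fun z => ((D.filter fun i => z i = 0).card : ℝ) with hs
  set m : ℝ := D.card / (2 * q) with hm
  have h1 : ∑ z ∈ A, s z ≤ m * A.card := by
    have : ∑ z ∈ A, s z = ∑ i ∈ D, ((A.filter fun z => z i = 0).card : ℝ) := by
      simp only [hs, Finset.card_filter, Nat.cast_sum]
      rw [Finset.sum_comm]
    rw [this]
    calc ∑ i ∈ D, ((A.filter fun z => z i = 0).card : ℝ) ≤ ∑ i ∈ D, (A.card : ℝ) / (2 * q) := by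
          apply Finset.sum_le_sum
          intro i hi
          rw [le_div_iff₀ (by positivity)]
          have := hD i hi
          have h' : (2 * q * (A.filter fun z => z i = 0).card : ℝ) ≤ A.card := by
            exact_mod_cast this
          linarith
      _ = m * A.card := by
          rw [Finset.sum_const, nsmul_eq_mul, hm]; ring
  -- Jensen's inequality, through the tangent line of `exp (-s)` at `s = m`, where `m` bounds the
  -- average of `s` on `A`.
  have h2 : A.card * Real.exp (-m) ≤ ∑ z ∈ A, Real.exp (-s z) := by
    calc A.card * Real.exp (-m) ≤ ∑ z ∈ A, Real.exp (-m) * (m - s z + 1) := by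
          rw [← Finset.mul_sum, mul_comm]
          gcongr
          simp only [Finset.sum_add_distrib, Finset.sum_sub_distrib, Finset.sum_const,
            nsmul_eq_mul, mul_one]
          linarith
      _ ≤ ∑ z ∈ A, Real.exp (-s z) := by
          apply Finset.sum_le_sum
          intro z _
          calc Real.exp (-m) * (m - s z + 1) ≤ Real.exp (-m) * Real.exp (m - s z) := by
                gcongr
                exact Real.add_one_le_exp _
            _ = Real.exp (-s z) := by rw [← Real.exp_add]; ring_nf
  have h3 : ∑ z ∈ A, Real.exp (-s z) ≤ ∑ z, Real.exp (-s z) :=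
    Finset.sum_le_sum_of_subset_of_nonneg (Finset.subset_univ A)
      fun _ _ _ => (Real.exp_pos _).le
  have h4 := h2.trans (h3.trans (sum_exp_neg_card_zeros D))
  have h5 : (A.card : ℝ) ≤ (q : ℝ) ^ n * Real.exp (-(6 / 10) * D.card / q) * Real.exp m := by
    rw [← div_le_iff₀ (Real.exp_pos _), div_eq_mul_inv, ← Real.exp_neg]
    exact h4
  refine h5.trans (le_of_eq ?_)
  rw [mul_assoc, ← Real.exp_add, hm]
  congr 2
  field_simp
  ring

/-- Every rectangle contains many intersecting pairs, up to a small additive error. -/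
theorem card_rectangle_le {n q k : ℕ} [NeZero q] (A : Finset (Fin n → Fin q))
    (B : Finset (Fin k → Fin n)) :
    ((A.card * B.card : ℕ) : ℝ) ≤
      2 * q * (((A ×ˢ B).filter fun p => ∃ j, p.1 (p.2 j) = 0).card : ℝ) +
        k.factorial * (10 * q) ^ k * (q : ℝ) ^ n := by
  have hq : (0 : ℝ) < q := by exact_mod_cast Nat.pos_of_ne_zero (NeZero.ne q)
  set D := Finset.univ.filter fun i : Fin n => 2 * q * (A.filter fun z => z i = 0).card ≤ A.card
    with hD
  have hcard := card_le_of_rare_zeros A D fun i hi => by simpa [hD] using hi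
  have hfib : ((A ×ˢ B).filter fun p => ∃ j, p.1 (p.2 j) = 0).card =
      ∑ y ∈ B, (A.filter fun z => ∃ j, z (y j) = 0).card := by
    simp only [Finset.card_filter]
    rw [Finset.sum_product_right]
  have h1 : A.card * B.card ≤ 2 * q * ∑ y ∈ B, (A.filter fun z => ∃ j, z (y j) = 0).card +
      A.card * D.card ^ k := by
    -- A tuple that leaves `D` meets a fraction above `1/(2q)` of `A` through a single coordinate;
    -- the tuples inside `D` are given up, and there are at most `|D|^k` of them.
    have h2 : ∀ y ∈ B, A.card ≤ 2 * q * (A.filter fun z => ∃ j, z (y j) = 0).card +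
        A.card * (if ∀ j, y j ∈ D then 1 else 0) := by
      intro y _
      split_ifs with h
      · omega
      · push Not at h
        obtain ⟨j, hj⟩ := h
        have hj' : A.card < 2 * q * (A.filter fun z => z (y j) = 0).card := by
          simpa [hD] using hj
        have : (A.filter fun z => z (y j) = 0).card ≤
            (A.filter fun z => ∃ j, z (y j) = 0).card := by
          apply Finset.card_le_card
          intro z hz
          simp only [Finset.mem_filter] at hz ⊢
          exact ⟨hz.1, j, hz.2⟩
        have := Nat.mul_le_mul_left (2 * q) this
        omega
    have h3 : ∑ y ∈ B, (if ∀ j, y j ∈ D then 1 else 0) ≤ D.card ^ k := by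
      rw [← Finset.card_filter]
      calc _ ≤ (Fintype.piFinset fun _ : Fin k => D).card := by
            apply Finset.card_le_card
            intro y hy
            simpa using (Finset.mem_filter.1 hy).2
        _ = D.card ^ k := by simp
    calc A.card * B.card = ∑ y ∈ B, A.card := by rw [Finset.sum_const, smul_eq_mul, mul_comm]
      _ ≤ _ := Finset.sum_le_sum h2
      _ ≤ _ := by
        rw [Finset.sum_add_distrib, ← Finset.mul_sum, ← Finset.mul_sum]
        gcongr
  -- The exponential smallness of `A` beats `|D|^k`, by `t^k / k! ≤ e^t` at `t = |D| / (10q)`.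
  have h4 : (A.card : ℝ) * D.card ^ k ≤ k.factorial * (10 * q) ^ k * (q : ℝ) ^ n := by
    have h5 := Real.pow_div_factorial_le_exp (D.card / (10 * q) : ℝ) (by positivity) k
    rw [div_pow, div_div, div_le_iff₀ (by positivity)] at h5
    calc (A.card : ℝ) * D.card ^ k
        ≤ ((q : ℝ) ^ n * Real.exp (-(D.card / (10 * q)))) *
          (Real.exp (D.card / (10 * q)) * ((10 * q) ^ k * k.factorial)) := by
          gcongr
      _ = (Real.exp (-(D.card / (10 * q))) * Real.exp (D.card / (10 * q))) *
          (k.factorial * (10 * q) ^ k * (q : ℝ) ^ n) := by ring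
      _ = _ := by rw [← Real.exp_add]; simp
  rw [hfib]
  have h1' : ((A.card * B.card : ℕ) : ℝ) ≤
      ((2 * q * ∑ y ∈ B, (A.filter fun z => ∃ j, z (y j) = 0).card +
      A.card * D.card ^ k : ℕ) : ℝ) := by exact_mod_cast h1
  push_cast at h1' ⊢
  linarith

/-! ### Signed weights on rectangles and amplification -/

section Rectangles

variable {X Y T : Type*}

/-- `P` and `τ` behave like acceptance and transcript of a two-party protocol: the accepting inputs
with a given transcript form a rectangle. -/
def Splices (P : X → Y → Prop) (τ : X → Y → T) : Prop :=
  ∀ x y x' y', P x y → P x' y' → τ x y = τ x' y' → P x y' ∧ τ x y' = τ x y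

-- The accepted pairs are a disjoint union of rectangles, one for each transcript. The weight may be
-- signed, so the bound is needed on all rectangles.
open Classical in
theorem Splices.sum_le [Fintype T] {P : X → Y → Prop} {τ : X → Y → T} (h : Splices P τ)
    (w : X → Y → ℝ) {b : ℝ} (hb : ∀ (A : Finset X) (B : Finset Y), ∑ x ∈ A, ∑ y ∈ B, w x y ≤ b)
    (A : Finset X) (B : Finset Y) :
    ∑ x ∈ A, ∑ y ∈ B, (if P x y then w x y else 0) ≤ Fintype.card T * b := by
  have key : ∀ x y, (if P x y then w x y else 0) =
      ∑ t : T, if (∃ y', P x y' ∧ τ x y' = t) ∧ (∃ x', P x' y ∧ τ x' y = t) then w x y else 0 := by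
    intro x y
    have h1 : ∀ t, ((∃ y', P x y' ∧ τ x y' = t) ∧ (∃ x', P x' y ∧ τ x' y = t)) ↔
        (P x y ∧ τ x y = t) := by
      intro t
      constructor
      · rintro ⟨⟨y', h1, h2⟩, x', h3, h4⟩
        obtain ⟨h5, h6⟩ := h x y' x' y h1 h3 (h2.trans h4.symm)
        exact ⟨h5, h6.trans h2⟩
      · rintro ⟨h1, h2⟩
        exact ⟨⟨y, h1, h2⟩, x, h1, h2⟩
    simp only [h1]
    by_cases hP : P x y
    · simp [hP]
    · simp [hP]
  have h2 : ∑ x ∈ A, ∑ y ∈ B, (if P x y then w x y else 0) =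
      ∑ t : T, ∑ x ∈ A.filter fun x => ∃ y', P x y' ∧ τ x y' = t,
        ∑ y ∈ B.filter fun y => ∃ x', P x' y ∧ τ x' y = t, w x y := by
    simp only [key, Finset.sum_filter]
    have h3 : ∀ x, ∑ y ∈ B, ∑ t : T, (if (∃ y', P x y' ∧ τ x y' = t) ∧
        (∃ x', P x' y ∧ τ x' y = t) then w x y else 0) = ∑ t : T, ∑ y ∈ B,
        (if (∃ y', P x y' ∧ τ x y' = t) ∧ (∃ x', P x' y ∧ τ x' y = t) then w x y else 0) :=
      fun x => Finset.sum_comm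
    simp only [h3]
    rw [Finset.sum_comm]
    refine Finset.sum_congr rfl fun t _ => Finset.sum_congr rfl fun x _ => ?_
    split_ifs with h4 <;> simp [h4]
  rw [h2]
  calc _ ≤ ∑ _t : T, b := Finset.sum_le_sum fun t _ => hb _ _
    _ = _ := by simp

/-- A bound on rectangles for a weight `w` yields a bound for `w` multiplied by powers of the
acceptance probability of a randomized protocol. -/
theorem sum_mul_pow_le [Fintype T] {Ω : Type*} [MeasurableSpace Ω] (μ : Measure Ω)
    [IsProbabilityMeasure μ] (P : Ω → X → Y → Prop) (τ : Ω → X → Y → T)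
    (hP : ∀ ω, Splices (P ω) (τ ω)) (hmeas : ∀ x y, MeasurableSet {ω | P ω x y})
    (w : X → Y → ℝ) {b : ℝ} (hb : ∀ (A : Finset X) (B : Finset Y), ∑ x ∈ A, ∑ y ∈ B, w x y ≤ b)
    (j : ℕ) (A : Finset X) (B : Finset Y) :
    ∑ x ∈ A, ∑ y ∈ B, w x y * μ.real {ω | P ω x y} ^ j ≤ (Fintype.card T : ℝ) ^ j * b := by
  classical
  induction j generalizing A B with
  | zero => simpa using hb A B
  | succ j ih =>
    -- The induction hypothesis is a bound for `v` on every rectangle, so `Splices.sum_le` applies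
    -- to `v` for each outcome of the coins; averaging supplies one more factor of the acceptance
    -- probability.
    set v : X → Y → ℝ := fun x y => w x y * μ.real {ω | P ω x y} ^ j with hv
    have hint : ∀ x y, Integrable (fun ω => if P ω x y then v x y else 0) μ := by
      intro x y
      have := (integrable_const (μ := μ) (v x y)).indicator (hmeas x y)
      refine this.congr (ae_of_all _ fun ω => ?_)
      simp [Set.indicator_apply]
    have hval : ∀ x y, ∫ ω, (if P ω x y then v x y else 0) ∂μ =
        w x y * μ.real {ω | P ω x y} ^ (j + 1) := by
      intro x y
      have : (fun ω => if P ω x y then v x y else 0) =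
          {ω | P ω x y}.indicator fun _ => v x y := by
        ext ω; simp [Set.indicator_apply]
      rw [this, integral_indicator_const _ (hmeas x y), smul_eq_mul, hv]
      ring
    have h1 : ∑ x ∈ A, ∑ y ∈ B, w x y * μ.real {ω | P ω x y} ^ (j + 1) =
        ∫ ω, ∑ x ∈ A, ∑ y ∈ B, (if P ω x y then v x y else 0) ∂μ := by
      rw [integral_finsetSum _ fun x _ => integrable_finsetSum _ fun y _ => hint x y]
      refine Finset.sum_congr rfl fun x _ => ?_
      rw [integral_finsetSum _ fun y _ => hint x y]
      exact Finset.sum_congr rfl fun y _ => (hval x y).symm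
    rw [h1]
    calc _ ≤ ∫ _ω, (Fintype.card T : ℝ) * ((Fintype.card T : ℝ) ^ j * b) ∂μ := by
          refine integral_mono
            (integrable_finsetSum _ fun x _ => integrable_finsetSum _ fun y _ => hint x y)
            (integrable_const _) fun ω => ?_
          exact (hP ω).sum_le v ih A B
      _ = _ := by
        simp only [integral_const, probReal_univ, one_smul]
        ring

end Rectangles

/-! ### Randomized lower bound for disjointness -/

/-- The bound on the transcripts of a protocol that separates disjoint from intersecting pairs. -/
theorem half_pow_le_of_protocol {T Ω : Type*} [Fintype T] [MeasurableSpace Ω] (μ : Measure Ω)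
    [IsProbabilityMeasure μ] {n k : ℕ} [NeZero (2 * k)]
    (P : Ω → (Fin n → Fin (2 * k)) → (Fin k → Fin n) → Prop)
    (τ : Ω → (Fin n → Fin (2 * k)) → (Fin k → Fin n) → T)
    (hP : ∀ ω, Splices (P ω) (τ ω)) (hmeas : ∀ z y, MeasurableSet {ω | P ω z y})
    (hn : 0 < n) {a b : ℝ} (ha : 0 ≤ a) (hb0 : 0 ≤ b)
    (hdisj : ∀ z y, (∀ j, z (y j) ≠ 0) → a ≤ μ.real {ω | P ω z y})
    (hint : ∀ z y, (∃ j, z (y j) = 0) → μ.real {ω | P ω z y} ≤ b) (j : ℕ) :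
    a ^ j / 2 ≤ 4 * k * b ^ j +
      (Fintype.card T : ℝ) ^ j * (k.factorial * (20 * k) ^ k) / (n : ℝ) ^ k := by
  classical
  set p : (Fin n → Fin (2 * k)) → (Fin k → Fin n) → ℝ := fun z y => μ.real {ω | P ω z y} with hp
  have hp0 : ∀ z y, 0 ≤ p z y := fun _ _ => measureReal_nonneg
  have hk : (0 : ℝ) < 2 * k := by
    have := Nat.pos_of_ne_zero (NeZero.ne (2 * k))
    exact_mod_cast this
  have hnR : (0 : ℝ) < n := by exact_mod_cast hn
  -- The coefficient is `2q` with `q = 2k`, which cancels the main term of `card_rectangle_le`.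
  set w : (Fin n → Fin (2 * k)) → (Fin k → Fin n) → ℝ :=
    fun z y => 1 - 4 * k * (if ∃ j, z (y j) = 0 then 1 else 0) with hw
  have hb : ∀ A B, ∑ z ∈ A, ∑ y ∈ B, w z y ≤
      k.factorial * (20 * k) ^ k * ((2 * k : ℝ)) ^ n := by
    intro A B
    have h := card_rectangle_le A B
    have h2 : (((A ×ˢ B).filter fun p => ∃ j, p.1 (p.2 j) = 0).card : ℝ) =
        ∑ z ∈ A, ∑ y ∈ B, (if ∃ j, z (y j) = 0 then (1 : ℝ) else 0) := by
      rw [Finset.card_filter, Finset.sum_product]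
      push_cast
      rfl
    rw [h2] at h
    simp only [hw, Finset.sum_sub_distrib, ← Finset.mul_sum]
    simp only [Finset.sum_const, nsmul_eq_mul, mul_one]
    push_cast at h
    have e1 : (10 * (2 * k) : ℝ) = 20 * k := by ring
    have e2 : (2 * (2 * k) : ℝ) = 4 * k := by ring
    rw [e1, e2] at h
    linarith
  have hmain := sum_mul_pow_le μ P τ hP hmeas w hb j Finset.univ Finset.univ
  set Z : ℝ := (2 * k : ℝ) ^ n with hZ
  set V : ℝ := (n : ℝ) ^ k with hV
  have hZ0 : 0 < Z := by positivity
  have hV0 : 0 < V := by positivity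
  have hterm : ∀ z y, (if ∀ j, z (y j) ≠ 0 then a ^ j else 0) - 4 * k * b ^ j ≤
      w z y * p z y ^ j := by
    intro z y
    by_cases h : ∃ j, z (y j) = 0
    · have h' : ¬ ∀ j, z (y j) ≠ 0 := by push Not; exact h
      have h1 : p z y ^ j ≤ b ^ j := pow_le_pow_left₀ (hp0 z y) (hint z y h) j
      have h2 : 0 ≤ p z y ^ j := pow_nonneg (hp0 z y) j
      simp only [hw, h, h', if_true, if_false]
      nlinarith
    · have h' : ∀ j, z (y j) ≠ 0 := by push Not at h; exact h
      have h1 : a ^ j ≤ p z y ^ j := pow_le_pow_left₀ ha (hdisj z y h') j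
      have h2 : 0 ≤ 4 * k * b ^ j := by positivity
      simp only [hw, if_pos h', if_neg h]
      linarith
  have hlow : a ^ j * (Z * V / 2) - 4 * k * b ^ j * (Z * V) ≤
      ∑ z, ∑ y, w z y * p z y ^ j := by
    refine le_trans ?_ (Finset.sum_le_sum fun z _ => Finset.sum_le_sum fun y _ => hterm z y)
    simp only [Finset.sum_sub_distrib, Finset.sum_const, Finset.card_univ, Fintype.card_pi,
      Fintype.card_fin, Finset.prod_const, nsmul_eq_mul]
    push_cast
    have h1 : a ^ j * (Z * V / 2) ≤ ∑ z : Fin n → Fin (2 * k), ∑ y : Fin k → Fin n,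
        (if ∀ j, z (y j) ≠ 0 then a ^ j else 0) := by
      rw [Finset.sum_comm]
      calc a ^ j * (Z * V / 2) = ∑ _y : Fin k → Fin n, a ^ j * (Z / 2) := by
            simp only [Finset.sum_const, Finset.card_univ, Fintype.card_pi, Fintype.card_fin,
              Finset.prod_const, nsmul_eq_mul]
            push_cast
            ring
        _ ≤ _ := by
          refine Finset.sum_le_sum fun y _ => ?_
          rw [← Finset.sum_filter, Finset.sum_const, nsmul_eq_mul, mul_comm]
          have h2 := half_le_card_disjoint y
          have h3 : Z ≤ 2 * ((Finset.univ.filter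
              fun z : Fin n → Fin (2 * k) => ∀ j, z (y j) ≠ 0).card : ℝ) := by
            rw [hZ]
            exact_mod_cast h2
          gcongr
          linarith
    have e : Z * (V * (4 * k * b ^ j)) = 4 * k * b ^ j * (Z * V) := by ring
    linarith
  have h := hlow.trans hmain
  have h2 : (a ^ j / 2) * (Z * V) ≤ (4 * k * b ^ j +
      (Fintype.card T : ℝ) ^ j * (k.factorial * (20 * k) ^ k) / V) * (Z * V) := by
    have e : (4 * k * b ^ j + (Fintype.card T : ℝ) ^ j * (k.factorial * (20 * k) ^ k) / V) *
        (Z * V) = 4 * k * b ^ j * (Z * V) +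
          (Fintype.card T : ℝ) ^ j * (k.factorial * (20 * k) ^ k * Z) := by
      field_simp
    rw [e]
    linarith
  exact le_of_mul_le_mul_right h2 (by positivity)

open Filter Topology in
/-- Randomized protocols with transcripts from a set of polynomial size cannot separate disjoint
pairs from intersecting ones. -/
theorem exists_size_no_protocol {a b : ℝ} (hb : 0 ≤ b) (hab : b < a) (C : ℕ) :
    ∃ n k : ℕ, 3 ≤ n ∧ 0 < k ∧ ∀ (_ : NeZero (2 * k)) (T Ω : Type) (_ : Fintype T)
      (_ : MeasurableSpace Ω) (μ : Measure Ω) (_ : IsProbabilityMeasure μ)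
      (P : Ω → (Fin n → Fin (2 * k)) → (Fin k → Fin n) → Prop)
      (τ : Ω → (Fin n → Fin (2 * k)) → (Fin k → Fin n) → T),
      Fintype.card T ≤ n ^ C → (∀ ω, Splices (P ω) (τ ω)) →
      (∀ z y, MeasurableSet {ω | P ω z y}) →
      (∀ z y, (∀ j, z (y j) ≠ 0) → a ≤ μ.real {ω | P ω z y}) →
      (∀ z y, (∃ j, z (y j) = 0) → μ.real {ω | P ω z y} ≤ b) → False := by
  have ha : 0 < a := hb.trans_lt hab
  have hr0 : 0 ≤ b / a := div_nonneg hb ha.le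
  have hr1 : b / a < 1 := (div_lt_one ha).2 hab
  -- Since `k` will depend linearly on `j`, the geometric decay of `(b/a)^j` has to absorb the
  -- factor `4k = 4(Cj + 1)`. Only afterwards is `n` chosen large.
  have hlim : Tendsto (fun j : ℕ => 4 * (C * ((j : ℝ) * (b / a) ^ j) + (b / a) ^ j)) atTop
      (𝓝 (4 * (C * 0 + 0))) :=
    (((tendsto_self_mul_const_pow_of_lt_one hr0 hr1).const_mul _).add
      (tendsto_pow_atTop_nhds_zero_of_lt_one hr0 hr1)).const_mul _
  obtain ⟨j, hj⟩ := (hlim.eventually_lt_const (show 4 * (C * 0 + 0) < (1 / 4 : ℝ) by norm_num)).exists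
  set k := C * j + 1 with hk
  set M : ℝ := k.factorial * (20 * k) ^ k with hM
  have haj : 0 < a ^ j := pow_pos ha j
  obtain ⟨n₀, hn₀⟩ := exists_nat_gt (4 * M / a ^ j)
  obtain ⟨n, hn3, hnn⟩ : ∃ n : ℕ, 3 ≤ n ∧ n₀ ≤ n := ⟨n₀ + 3, by omega, by omega⟩
  refine ⟨n, k, hn3, by omega, ?_⟩
  intro _ T Ω _ _ μ _ P τ hT hP hmeas hdisj hint
  have h := half_pow_le_of_protocol μ P τ hP hmeas (by omega) ha.le hb hdisj hint j
  have hnR : (0 : ℝ) < n := by exact_mod_cast (show 0 < n by omega)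
  have h1 : 4 * k * b ^ j < a ^ j / 4 := by
    have e : 4 * (C * ((j : ℝ) * (b / a) ^ j) + (b / a) ^ j) = 4 * k * b ^ j / a ^ j := by
      rw [hk, div_pow]; push_cast; field_simp
    rw [e, div_lt_iff₀ haj] at hj
    linarith
  have h2 : (Fintype.card T : ℝ) ^ j * M / (n : ℝ) ^ k ≤ M / n := by
    have h3 : (Fintype.card T : ℝ) ^ j ≤ (n : ℝ) ^ (C * j) := by
      rw [pow_mul]
      exact pow_le_pow_left₀ (by positivity) (by exact_mod_cast hT) j
    rw [div_le_div_iff₀ (by positivity) hnR, hk, pow_succ]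
    have hM0 : 0 ≤ M := by positivity
    calc (Fintype.card T : ℝ) ^ j * M * n ≤ (n : ℝ) ^ (C * j) * M * n := by gcongr
      _ = _ := by ring
  have h4 : M / n < a ^ j / 4 := by
    rw [div_lt_iff₀ hnR]
    rw [div_lt_iff₀ haj] at hn₀
    have : (n₀ : ℝ) ≤ n := by exact_mod_cast hnn
    nlinarith
  linarith

namespace HybridModels

/-! ## Disjointness on paths as a property of the labeled graph -/

theorem IsDisjPath.index_of_label_ne_nil {I : LabeledGraph} {n : ℕ} {x y : Fin n → Bool}
    {e : SimpleGraph.pathGraph (2 * n) ≃g I.graph}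
    (he : ∀ j : Fin (2 * n), I.label (e j) =
      if (j : ℕ) = n - 2 then List.ofFn x else if (j : ℕ) = n + 1 then List.ofFn y else [])
    {j : Fin (2 * n)} {i : ℕ} (h : (I.label (e j))[i]? = some true) :
    (j : ℕ) = n - 2 ∨ (j : ℕ) = n + 1 := by
  by_contra hc
  push Not at hc
  rw [he, if_neg hc.1, if_neg hc.2] at h
  simp at h

/-- On a path, disjointness says that no index is set in the labels of two different vertices. -/
theorem IsDisjPath.disj_iff {I : LabeledGraph} {n : ℕ} {x y : Fin n → Bool}
    (h : IsDisjPath I n x y) :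
    Disj x y ↔ ∀ u v, u ≠ v → ∀ i : ℕ,
      ¬ ((I.label u)[i]? = some true ∧ (I.label v)[i]? = some true) := by
  obtain ⟨hn, e, he⟩ := h
  constructor
  · rintro hd u v huv i ⟨hu, hv⟩
    obtain ⟨a, rfl⟩ := e.surjective u
    obtain ⟨b, rfl⟩ := e.surjective v
    have hab : (a : ℕ) ≠ b := fun hab => huv (by rw [Fin.ext hab])
    have ha := index_of_label_ne_nil he hu
    have hb := index_of_label_ne_nil he hv
    rw [he] at hu hv
    have hne : n + 1 ≠ n - 2 := by omega
    rcases ha with ha | ha <;> rcases hb with hb | hb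
    · omega
    · simp only [ha, hb, if_true, if_neg hne] at hu hv
      rw [List.getElem?_ofFn] at hu hv
      by_cases hi : i < n
      · simp only [hi, dite_true, Option.some.injEq] at hu hv
        exact hd _ ⟨hu, hv⟩
      · simp [hi] at hu
    · simp only [ha, hb, if_true, if_neg hne] at hu hv
      rw [List.getElem?_ofFn] at hu hv
      by_cases hi : i < n
      · simp only [hi, dite_true, Option.some.injEq] at hu hv
        exact hd _ ⟨hv, hu⟩
      · simp [hi] at hu
    · omega
  · rintro hd i ⟨hx, hy⟩
    have hi := i.isLt
    refine hd (e ⟨n - 2, by omega⟩) (e ⟨n + 1, by omega⟩) ?_ i ⟨?_, ?_⟩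
    · intro heq
      have := congrArg Fin.val (e.injective heq)
      simp only at this
      omega
    · rw [he]
      simp [hx]
    · rw [he]
      have hne : n + 1 ≠ n - 2 := by omega
      simp [hne, hy]

/-- A labeled graph may be presented as such a path in several ways, for instance by reversal. The
label criterion `disj_iff` shows that disjointness does not depend on the presentation. -/
theorem IsDisjPath.mem_iff_disj {𝓛 : DistLanguage} (h𝓛 : 𝓛 ∩ disjPaths = disjointnessOnPath)
    {I : LabeledGraph} {n : ℕ} {x y : Fin n → Bool} (h : IsDisjPath I n x y) :
    I ∈ 𝓛 ↔ Disj x y := by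
  constructor
  · intro hI
    have : I ∈ disjointnessOnPath := h𝓛 ▸ ⟨hI, n, x, y, h⟩
    obtain ⟨n', x', y', h', hd⟩ := this
    exact h.disj_iff.2 (h'.disj_iff.1 hd)
  · intro hd
    have : I ∈ 𝓛 ∩ disjPaths := h𝓛 ▸ ⟨n, x, y, h, hd⟩
    exact this.1

/-! ## Executions on paths -/

/-- The path with inputs `x` and `y`, on the vertices `0, …, 2 * n - 1`. -/
def pathInstance (n : ℕ) (hn : 2 < n) (x y : Fin n → Bool) : LabeledGraph where
  n := 2 * n
  n_pos := by omega
  graph := SimpleGraph.pathGraph (2 * n)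
  label := fun j => if (j : ℕ) = n - 2 then List.ofFn x
    else if (j : ℕ) = n + 1 then List.ofFn y else []

theorem isDisjPath_pathInstance (n : ℕ) (hn : 2 < n) (x y : Fin n → Bool) :
    IsDisjPath (pathInstance n hn x y) n x y :=
  ⟨hn, SimpleGraph.Iso.refl, fun _ => rfl⟩

/-- The identifiers `1, …, 2 * n`, in the order of the path. -/
def pathId (n : ℕ) (v : Fin (2 * n)) : ℕ := v + 1

theorem isIdAssignment_pathId {N : ℕ → ℕ} (hN : ∀ n, n ≤ N n) (n : ℕ) (hn : 2 < n)
    (x y : Fin n → Bool) : IsIdAssignment N (pathInstance n hn x y) (pathId n) := by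
  constructor
  · intro u v h
    exact Fin.ext (Nat.succ_injective h)
  · intro v
    exact ⟨Nat.succ_pos _, (Nat.succ_le_of_lt v.isLt).trans (hN _)⟩

section Execution

variable {n : ℕ} (hn : 2 < n) (A : Algorithm)

/-- The initial knowledge of `v` on the path with inputs `x` and `y`. -/
noncomputable def pathInput (x y : Fin n → Bool) (v : Fin (2 * n)) : NodeInput :=
  nodeInput (pathInstance n hn x y) (pathId n) v

/-- What `v` receives in the first of the rounds, of kind `k`. -/
noncomputable def pathReceived₁ (k : RoundKind) (x y : Fin n → Bool) (v : Fin (2 * n)) : Reception :=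
  received A (pathInstance n hn x y) (pathId n) k (fun _ => []) v

/-- What `v` receives in the second of two rounds, of kinds `k` and `l`. -/
noncomputable def pathReceived₂ (k l : RoundKind) (x y : Fin n → Bool) (v : Fin (2 * n)) : Reception :=
  received A (pathInstance n hn x y) (pathId n) l
    (fun w => [pathReceived₁ hn A k x y w]) v

theorem allAccept_pathInstance_iff (k l : RoundKind) (x y : Fin n → Bool) :
    AllAccept A [k, l] (pathInstance n hn x y) (pathId n) ↔
      ∀ v, A.output (pathInput hn x y v)
        [pathReceived₁ hn A k x y v, pathReceived₂ hn A k l x y v] = true :=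
  Iff.rfl

variable {hn} {A}

theorem pathInput_eq_of_label {x y x' y' : Fin n → Bool} {v : Fin (2 * n)}
    (h : (pathInstance n hn x y).label v = (pathInstance n hn x' y').label v) :
    pathInput hn x y v = pathInput hn x' y' v := by
  change NodeInput.mk _ _ _ _ = NodeInput.mk _ _ _ _
  congr 1

theorem pathInput_left (x y y' : Fin n → Bool) {v : Fin (2 * n)} (hv : (v : ℕ) < n) :
    pathInput hn x y v = pathInput hn x y' v := by
  apply pathInput_eq_of_label
  have : (v : ℕ) ≠ n + 1 := by omega
  simp [pathInstance, this]

theorem pathInput_right (x x' y : Fin n → Bool) {v : Fin (2 * n)} (hv : n ≤ (v : ℕ)) :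
    pathInput hn x y v = pathInput hn x' y v := by
  apply pathInput_eq_of_label
  have : (v : ℕ) ≠ n - 2 := by omega
  simp [pathInstance, this]

theorem pathInput_far (x y x' y' : Fin n → Bool) {v : Fin (2 * n)} (hv : (v : ℕ) ≠ n - 2)
    (hv' : (v : ℕ) ≠ n + 1) : pathInput hn x y v = pathInput hn x' y' v := by
  apply pathInput_eq_of_label
  simp [pathInstance, hv, hv']

open Classical in
theorem received_neighbors_congr {k : RoundKind} (hk : k ≠ .BCC) {x y x' y' : Fin n → Bool}
    {h h' : Fin (2 * n) → List Reception} {v : Fin (2 * n)}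
    (hw : ∀ w : Fin (2 * n), (v : ℕ) + 1 = w ∨ (w : ℕ) + 1 = v →
      A.send (pathInput hn x y w) (h w) (pathId n v) =
        A.send (pathInput hn x' y' w) (h' w) (pathId n v)) :
    received A (pathInstance n hn x y) (pathId n) k h v =
      received A (pathInstance n hn x' y') (pathId n) k h' v := by
  have key : ∀ w : Fin (2 * n), (SimpleGraph.pathGraph (2 * n)).Adj v w →
      (pathId n w, A.send (pathInput hn x y w) (h w) (pathId n v)) =
        (pathId n w, A.send (pathInput hn x' y' w) (h' w) (pathId n v)) := by
    intro w hvw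
    rw [hw w (SimpleGraph.pathGraph_adj.1 hvw)]
  cases k with
  | BCC => exact absurd rfl hk
  | LOCAL => exact Finset.image_congr fun w hw' => key w (Finset.mem_filter.1 hw').2
  | CONGEST => exact Finset.image_congr fun w hw' => key w (Finset.mem_filter.1 hw').2

theorem received_BCC_congr {x y x' y' : Fin n → Bool} {h h' : Fin (2 * n) → List Reception}
    (hw : ∀ w : Fin (2 * n), A.bcast (pathInput hn x y w) (h w) =
      A.bcast (pathInput hn x' y' w) (h' w)) (v : Fin (2 * n)) :
    received A (pathInstance n hn x y) (pathId n) .BCC h v =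
      received A (pathInstance n hn x' y') (pathId n) .BCC h' v := by
  refine Finset.image_congr fun w _ => ?_
  exact congrArg (Prod.mk (pathId n w)) (hw w)

/-- After one round of messages to neighbors, the left half does not know `y`. -/
theorem pathReceived₁_left {k : RoundKind} (hk : k ≠ .BCC) (x y y' : Fin n → Bool)
    {v : Fin (2 * n)} (hv : (v : ℕ) < n) :
    pathReceived₁ hn A k x y v = pathReceived₁ hn A k x y' v := by
  refine received_neighbors_congr hk fun w hw => ?_
  by_cases h : (w : ℕ) < n
  · rw [pathInput_left x y y' h]
  · rw [pathInput_far x y x y' (v := w) (by omega) (by omega)]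

/-- After one round of messages to neighbors, the right half does not know `x`. -/
theorem pathReceived₁_right {k : RoundKind} (hk : k ≠ .BCC) (x x' y : Fin n → Bool)
    {v : Fin (2 * n)} (hv : n ≤ (v : ℕ)) :
    pathReceived₁ hn A k x y v = pathReceived₁ hn A k x' y v := by
  refine received_neighbors_congr hk fun w hw => ?_
  by_cases h : n ≤ (w : ℕ)
  · rw [pathInput_right x x' y h]
  · rw [pathInput_far x y x' y (v := w) (by omega) (by omega)]

theorem pathReceived₁_far {k : RoundKind} (hk : k ≠ .BCC) (x y x' y' : Fin n → Bool)
    {v : Fin (2 * n)} (hv : (v : ℕ) + 3 < n ∨ n + 2 < (v : ℕ)) :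
    pathReceived₁ hn A k x y v = pathReceived₁ hn A k x' y' v := by
  refine received_neighbors_congr hk fun w hw => ?_
  rw [pathInput_far x y x' y' (v := w) (by omega) (by omega)]

/-- If the histories on inputs `(x, y')` agree with those on `(x, y)` in the left half and with those
on `(x', y')` in the right half, then acceptance on the latter two implies acceptance on `(x, y')`. -/
theorem allAccept_of_splice {k l : RoundKind} {x y x' y' : Fin n → Bool}
    (hl : ∀ v : Fin (2 * n), (v : ℕ) < n →
      pathReceived₁ hn A k x y' v = pathReceived₁ hn A k x y v ∧
      pathReceived₂ hn A k l x y' v = pathReceived₂ hn A k l x y v)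
    (hr : ∀ v : Fin (2 * n), n ≤ (v : ℕ) →
      pathReceived₁ hn A k x y' v = pathReceived₁ hn A k x' y' v ∧
      pathReceived₂ hn A k l x y' v = pathReceived₂ hn A k l x' y' v)
    (h : AllAccept A [k, l] (pathInstance n hn x y) (pathId n))
    (h' : AllAccept A [k, l] (pathInstance n hn x' y') (pathId n)) :
    AllAccept A [k, l] (pathInstance n hn x y') (pathId n) := by
  rw [allAccept_pathInstance_iff] at h h' ⊢
  intro v
  rcases lt_or_ge (v : ℕ) n with hv | hv
  · rw [(hl v hv).1, (hl v hv).2, pathInput_left x y' y hv]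
    exact h v
  · rw [(hr v hv).1, (hr v hv).2, pathInput_right x x' y' hv]
    exact h' v

variable (hn) (A)

/-- Only the two labeled vertices can surprise anyone: every other broadcast is determined by the
broadcasts heard before. Their four messages form the transcript; the empty entries pad it to six.
-/
theorem exists_transcript_BCC_BCC {c : ℕ} (hA : RespectsBandwidth A [.BCC, .BCC] c) :
    ∃ τ : (Fin n → Bool) → (Fin n → Bool) → Fin 6 → List Bool,
      (∀ x y i, (τ x y i).length ≤ c * (Nat.log 2 (2 * n) + 1)) ∧
      Splices (fun x y => AllAccept A [.BCC, .BCC] (pathInstance n hn x y) (pathId n)) τ := by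
  set u : Fin (2 * n) := ⟨n - 2, by omega⟩ with hu
  set v : Fin (2 * n) := ⟨n + 1, by omega⟩ with hv
  set b₁ := fun x y w => A.bcast (pathInput hn x y w) [] with hb₁
  set b₂ := fun x y w => A.bcast (pathInput hn x y w) [pathReceived₁ hn A .BCC x y w] with hb₂
  refine ⟨fun x y => ![b₁ x y u, b₁ x y v, b₂ x y u, b₂ x y v, [], []], ?_, ?_⟩
  · have h1 : ∀ x y w, (b₁ x y w).length ≤ c * (Nat.log 2 (2 * n) + 1) :=
      fun x y w => (hA (pathInput hn x y w) []).2 rfl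
    have h2 : ∀ x y w, (b₂ x y w).length ≤ c * (Nat.log 2 (2 * n) + 1) :=
      fun x y w => (hA (pathInput hn x y w) [_]).2 rfl
    intro x y i
    fin_cases i <;> simp [h1, h2]
  · intro x y x' y' h h' hτ
    have e1 : b₁ x y u = b₁ x' y' u := congrFun hτ 0
    have e2 : b₁ x y v = b₁ x' y' v := congrFun hτ 1
    have e3 : b₂ x y u = b₂ x' y' u := congrFun hτ 2
    have e4 : b₂ x y v = b₂ x' y' v := congrFun hτ 3
    have cases_uv : ∀ w : Fin (2 * n), w = u ∨ w = v ∨ ((w : ℕ) ≠ n - 2 ∧ (w : ℕ) ≠ n + 1) := by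
      intro w
      simp only [hu, hv, Fin.ext_iff]
      tauto
    have f1 : ∀ w, b₁ x y w = b₁ x' y' w := by
      intro w
      rcases cases_uv w with rfl | rfl | hw
      · exact e1
      · exact e2
      · simp only [hb₁, pathInput_far x y x' y' hw.1 hw.2]
    -- On the mixed input the left half speaks as on `(x, y)` and the right half as on `(x', y')`;
    -- equality of transcripts makes these two executions sound alike.
    have f1' : ∀ w, b₁ x y' w = b₁ x y w := by
      intro w
      rcases lt_or_ge (w : ℕ) n with hw | hw
      · simp only [hb₁, pathInput_left x y' y hw]
      · rw [f1]
        simp only [hb₁, pathInput_right x x' y' hw]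
    have g1 : ∀ w, pathReceived₁ hn A .BCC x y w = pathReceived₁ hn A .BCC x' y' w :=
      received_BCC_congr f1
    have g1' : ∀ w, pathReceived₁ hn A .BCC x y' w = pathReceived₁ hn A .BCC x y w :=
      received_BCC_congr f1'
    have f2 : ∀ w, b₂ x y w = b₂ x' y' w := by
      intro w
      rcases cases_uv w with rfl | rfl | hw
      · exact e3
      · exact e4
      · simp only [hb₂, pathInput_far x y x' y' hw.1 hw.2, g1]
    have f2' : ∀ w, b₂ x y' w = b₂ x y w := by
      intro w
      rcases lt_or_ge (w : ℕ) n with hw | hw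
      · simp only [hb₂, pathInput_left x y' y hw, g1']
      · rw [f2]
        simp only [hb₂, pathInput_right x x' y' hw, g1', g1]
    have g2 : ∀ w, pathReceived₂ hn A .BCC .BCC x y w = pathReceived₂ hn A .BCC .BCC x' y' w :=
      received_BCC_congr f2
    have g2' : ∀ w, pathReceived₂ hn A .BCC .BCC x y' w = pathReceived₂ hn A .BCC .BCC x y w :=
      received_BCC_congr f2'
    refine ⟨allAccept_of_splice (fun w _ => ⟨g1' w, g2' w⟩)
      (fun w _ => ⟨(g1' w).trans (g1 w), (g2' w).trans (g2 w)⟩) h h', ?_⟩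
    simp only [f1', f2']

/-- After the LOCAL round the inputs have reached only the labeled vertices and their neighbors,
which are the six vertices `n - 3, …, n + 2`, and neither has crossed the middle edge. The
broadcasts of these six are the transcript. -/
theorem exists_transcript_LOCAL_BCC {c : ℕ} (hA : RespectsBandwidth A [.LOCAL, .BCC] c) :
    ∃ τ : (Fin n → Bool) → (Fin n → Bool) → Fin 6 → List Bool,
      (∀ x y i, (τ x y i).length ≤ c * (Nat.log 2 (2 * n) + 1)) ∧
      Splices (fun x y => AllAccept A [.LOCAL, .BCC] (pathInstance n hn x y) (pathId n)) τ := by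
  have hk : RoundKind.LOCAL ≠ .BCC := by simp
  set b := fun x y w => A.bcast (pathInput hn x y w) [pathReceived₁ hn A .LOCAL x y w] with hb
  refine ⟨fun x y i => b x y ⟨n - 3 + i, by omega⟩,
    fun x y i => (hA (pathInput hn x y _) [_]).2 rfl, ?_⟩
  intro x y x' y' h h' hτ
  have f : ∀ w, b x y w = b x' y' w := by
    intro w
    by_cases hw : (w : ℕ) + 3 < n ∨ n + 2 < (w : ℕ)
    · simp only [hb]
      rw [pathInput_far x y x' y' (v := w) (by omega) (by omega), pathReceived₁_far hk x y x' y' hw]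
    · have hlt : (w : ℕ) - (n - 3) < 6 := by omega
      have hw' : w = ⟨n - 3 + ((⟨(w : ℕ) - (n - 3), hlt⟩ : Fin 6) : ℕ), by simp only; omega⟩ := by
        ext
        simp only
        omega
      rw [hw']
      exact congrFun hτ _
  have f' : ∀ w, b x y' w = b x y w := by
    intro w
    rcases lt_or_ge (w : ℕ) n with hw | hw
    · simp only [hb, pathInput_left x y' y hw, pathReceived₁_left hk x y' y hw]
    · rw [f]
      simp only [hb, pathInput_right x x' y' hw, pathReceived₁_right hk x x' y' hw]
  have g : ∀ w, pathReceived₂ hn A .LOCAL .BCC x y w = pathReceived₂ hn A .LOCAL .BCC x' y' w :=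
    received_BCC_congr f
  have g' : ∀ w, pathReceived₂ hn A .LOCAL .BCC x y' w = pathReceived₂ hn A .LOCAL .BCC x y w :=
    received_BCC_congr f'
  refine ⟨allAccept_of_splice (fun w hw => ⟨pathReceived₁_left hk x y' y hw, g' w⟩)
    (fun w hw => ⟨pathReceived₁_right hk x x' y' hw, (g' w).trans (g w)⟩) h h', ?_⟩
  simp only [f']

/-- No input crosses the middle edge in the first round, so all that a half learns about the other
input is carried by the two second-round messages on that edge. -/
theorem exists_transcript_CONGEST_CONGEST {c : ℕ}
    (hA : RespectsBandwidth A [.CONGEST, .CONGEST] c) :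
    ∃ τ : (Fin n → Bool) → (Fin n → Bool) → Fin 6 → List Bool,
      (∀ x y i, (τ x y i).length ≤ c * (Nat.log 2 (2 * n) + 1)) ∧
      Splices (fun x y => AllAccept A [.CONGEST, .CONGEST] (pathInstance n hn x y) (pathId n))
        τ := by
  have hk : RoundKind.CONGEST ≠ .BCC := by simp
  set u : Fin (2 * n) := ⟨n - 1, by omega⟩ with hu
  set v : Fin (2 * n) := ⟨n, by omega⟩ with hv
  set m := fun x y w t =>
    A.send (pathInput hn x y w) [pathReceived₁ hn A .CONGEST x y w] (pathId n t) with hm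
  refine ⟨fun x y => ![m x y u v, m x y v u, [], [], [], []], ?_, ?_⟩
  · have h1 : ∀ x y w t, (m x y w t).length ≤ c * (Nat.log 2 (2 * n) + 1) :=
      fun x y w t => (hA (pathInput hn x y w) [_]).1 rfl _
    intro x y i
    fin_cases i <;> simp [h1]
  · intro x y x' y' h h' hτ
    have e1 : m x y u v = m x' y' u v := congrFun hτ 0
    have e2 : m x y v u = m x' y' v u := congrFun hτ 1
    have fl : ∀ w t : Fin (2 * n), (w : ℕ) < n → m x y' w t = m x y w t := by
      intro w t hw
      simp only [hm, pathInput_left x y' y hw, pathReceived₁_left hk x y' y hw]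
    have fr : ∀ w t : Fin (2 * n), n ≤ (w : ℕ) → m x y' w t = m x' y' w t := by
      intro w t hw
      simp only [hm, pathInput_right x x' y' hw, pathReceived₁_right hk x x' y' hw]
    have hun : (u : ℕ) < n := by simp only [hu]; omega
    refine ⟨allAccept_of_splice (fun w hw => ⟨pathReceived₁_left hk x y' y hw, ?_⟩)
      (fun w hw => ⟨pathReceived₁_right hk x x' y' hw, ?_⟩) h h', ?_⟩
    · refine received_neighbors_congr hk fun t ht => ?_
      rcases lt_or_ge (t : ℕ) n with htn | htn
      · exact fl t w htn
      · have h1 : t = v := Fin.ext (by simp only [hv]; omega)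
        have h2 : w = u := Fin.ext (by simp only [hu]; omega)
        subst h1 h2
        exact (fr v u le_rfl).trans e2.symm
    · refine received_neighbors_congr hk fun t ht => ?_
      rcases lt_or_ge (t : ℕ) n with htn | htn
      · have h1 : t = u := Fin.ext (by simp only [hu]; omega)
        have h2 : w = v := Fin.ext (by simp only [hv]; omega)
        subst h1 h2
        exact (fl u v hun).trans e1
      · exact fr t w htn
    · simp only [fl u v hun, (fr v u le_rfl).trans e2.symm]

end Execution

/-! ## Lower bounds -/

/-- A string, truncated to `L` symbols, as a word of length `L` over an alphabet of size `3`. -/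
def paddedString (L : ℕ) (l : List Bool) : Fin L → Option Bool := fun i => l[(i : ℕ)]?

theorem paddedString_injOn {L : ℕ} {l l' : List Bool} (hl : l.length ≤ L) (hl' : l'.length ≤ L)
    (h : paddedString L l = paddedString L l') : l = l' := by
  apply List.ext_getElem?
  intro i
  by_cases hi : i < L
  · exact congrFun h ⟨i, hi⟩
  · rw [List.getElem?_eq_none (by omega), List.getElem?_eq_none (by omega)]

theorem card_transcripts_le {n : ℕ} (hn : 2 < n) (c : ℕ) :
    Fintype.card (Fin 6 → Fin (c * (Nat.log 2 (2 * n) + 1)) → Option Bool) ≤ n ^ (30 * c) := by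
  simp only [Fintype.card_pi, Fintype.card_option, Fintype.card_bool, Finset.prod_const,
    Finset.card_univ, Fintype.card_fin]
  have h1 : 2 ^ (Nat.log 2 (2 * n) + 1) ≤ n ^ 3 := by
    have h2 := Nat.pow_log_le_self 2 (x := 2 * n) (by omega)
    have h3 : 9 * n ≤ n ^ 3 := by
      have h4 : 3 * 3 ≤ n * n := Nat.mul_le_mul hn hn
      calc 9 * n ≤ n * n * n := Nat.mul_le_mul_right n h4
        _ = n ^ 3 := by ring
    rw [pow_succ]
    omega
  -- The exponent is `30 = 10 · 3`, from `3^6 ≤ 2^10` and `2^(log₂(2n) + 1) ≤ 4n ≤ n^3`.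
  calc ((2 + 1) ^ (c * (Nat.log 2 (2 * n) + 1))) ^ 6
      = ((2 + 1) ^ 6) ^ (c * (Nat.log 2 (2 * n) + 1)) := pow_right_comm _ _ _
    _ ≤ (2 ^ 10) ^ (c * (Nat.log 2 (2 * n) + 1)) := Nat.pow_le_pow_left (by norm_num) _
    _ = (2 ^ (Nat.log 2 (2 * n) + 1)) ^ (10 * c) := by
      rw [← pow_mul, ← pow_mul]
      congr 1
      ring
    _ ≤ (n ^ 3) ^ (10 * c) := Nat.pow_le_pow_left h1 _
    _ = n ^ (30 * c) := by
      rw [← pow_mul]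
      congr 1
      ring

/-- A model in which few messages determine what the two halves of a path learn from each other
cannot decide disjointness on paths. -/
theorem notMem_randHybridClass {N : ℕ → ℕ} (hN : ∀ n, n ≤ N n) {𝓛 : DistLanguage}
    (h𝓛 : 𝓛 ∩ disjPaths = disjointnessOnPath) {rs : List RoundKind}
    (hrs : ∀ {n : ℕ} (hn : 2 < n) (A : Algorithm) {c : ℕ}, RespectsBandwidth A rs c →
      ∃ τ : (Fin n → Bool) → (Fin n → Bool) → Fin 6 → List Bool,
        (∀ x y i, (τ x y i).length ≤ c * (Nat.log 2 (2 * n) + 1)) ∧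
        Splices (fun x y => AllAccept A rs (pathInstance n hn x y) (pathId n)) τ)
    {ε : ℝ} (hε : 0 < ε) : 𝓛 ∉ randHybridClass N rs (1 / 2 - ε) := by
  rintro ⟨Ω, _, μ, _, A, c, hA, hdec⟩
  -- The minimum with 1/4 keeps the lower threshold nonnegative when `ε` is large.
  obtain ⟨n, k, hn, hk, hno⟩ := exists_size_no_protocol (a := 1 / 2 + min ε (1 / 4))
    (b := 1 / 2 - min ε (1 / 4)) (by have := min_le_right ε (1 / 4 : ℝ); linarith)
    (by have := lt_min hε (show (0 : ℝ) < 1 / 4 by norm_num); linarith) (30 * c)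
  have hk' : NeZero (2 * k) := ⟨by omega⟩
  choose τ hτ hsplice using fun ω => hrs hn (A ω) (hA ω)
  set x : (Fin n → Fin (2 * k)) → Fin n → Bool := fun z i => decide (z i = 0) with hx
  set y : (Fin k → Fin n) → Fin n → Bool := fun t i => decide (∃ j, t j = i) with hy
  have hdisj : ∀ z t, Disj (x z) (y t) ↔ ∀ j, z (t j) ≠ 0 := by
    intro z t
    simp only [Disj, hx, hy, decide_eq_true_eq]
    constructor
    · exact fun h j hj => h _ ⟨hj, j, rfl⟩
    · rintro h i ⟨hi, j, rfl⟩
      exact h j hi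
  have hmem : ∀ z t, pathInstance n hn (x z) (y t) ∈ 𝓛 ↔ ∀ j, z (t j) ≠ 0 := fun z t =>
    ((isDisjPath_pathInstance n hn _ _).mem_iff_disj h𝓛).trans (hdisj z t)
  have hrun := fun z t => hdec (pathInstance n hn (x z) (y t)) (pathId n)
    (isIdAssignment_pathId hN n hn _ _)
  refine hno hk' (Fin 6 → Fin (c * (Nat.log 2 (2 * n) + 1)) → Option Bool) Ω inferInstance
    inferInstance μ inferInstance
    (fun ω z t => AllAccept (A ω) rs (pathInstance n hn (x z) (y t)) (pathId n))
    (fun ω z t i => paddedString _ (τ ω (x z) (y t) i)) (card_transcripts_le hn c) ?_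
    (fun z t => (hrun z t).1) ?_ ?_
  · intro ω z t z' t' h h' hτ'
    have h1 : τ ω (x z) (y t) = τ ω (x z') (y t') :=
      funext fun i => paddedString_injOn (hτ ω _ _ i) (hτ ω _ _ i) (congrFun hτ' i)
    obtain ⟨h2, h3⟩ := hsplice ω _ _ _ _ h h' h1
    exact ⟨h2, by simp only [h3]⟩
  · intro z t hzt
    have h1 := (hrun z t).2
    simp only [(hmem z t).2 hzt, iff_true] at h1
    have h2 := probReal_compl_eq_one_sub (μ := μ) (hrun z t).1
    rw [Set.compl_ofPred] at h2
    have := min_le_left ε (1 / 4 : ℝ)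
    linarith
  · rintro z t ⟨j, hj⟩
    have h1 := (hrun z t).2
    have h2 : pathInstance n hn (x z) (y t) ∉ 𝓛 := fun h => (hmem z t).1 h j hj
    simp only [h2, iff_false, not_not] at h1
    have := min_le_left ε (1 / 4 : ℝ)
    linarith

theorem hybridClass_subset_randHybridClass (N : ℕ → ℕ) (rs : List RoundKind) {δ : ℝ}
    (hδ : 0 ≤ δ) : hybridClass N rs ⊆ randHybridClass N rs δ := by
  rintro 𝓛 ⟨A, c, hA, hdec⟩
  refine ⟨Unit, ⊤, Measure.dirac (), inferInstance, fun _ => A, c, fun _ => hA, fun I id hid =>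
    ⟨MeasurableSpace.measurableSet_top, ?_⟩⟩
  simpa [hdec I id hid] using hδ

/-! ## The algorithm with two LOCAL rounds -/

/-- No index is set in both labels at the ends of a walk of length `3`. -/
def disjointOnWalks : DistLanguage :=
  {I | ∀ a b c d, I.graph.Adj a b → I.graph.Adj b c → I.graph.Adj c d → ∀ i : ℕ,
    ¬ ((I.label a)[i]? = some true ∧ (I.label d)[i]? = some true)}

theorem disjointOnWalks_inter_disjPaths : disjointOnWalks ∩ disjPaths = disjointnessOnPath := by
  have key : ∀ {I : LabeledGraph} {n : ℕ} {x y : Fin n → Bool}, IsDisjPath I n x y →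
      (I ∈ disjointOnWalks ↔ Disj x y) := by
    intro I n x y h
    constructor
    · obtain ⟨hn, e, he⟩ := h
      rintro hI i ⟨hx, hy⟩
      have hi := i.isLt
      have hadj : ∀ (u : ℕ) (hu : u + 1 < 2 * n),
          I.graph.Adj (e ⟨u, by omega⟩) (e ⟨u + 1, hu⟩) := by
        intro u hu
        rw [e.map_adj_iff, SimpleGraph.pathGraph_adj]
        exact Or.inl rfl
      refine hI (e ⟨n - 2, by omega⟩) _ _ (e ⟨n - 2 + 1 + 1 + 1, by omega⟩) (hadj _ (by omega))
        (hadj _ (by omega)) (hadj _ (by omega)) i ⟨?_, ?_⟩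
      · rw [he]
        simp [hx]
      · rw [he]
        have h1 : n - 2 + 1 + 1 + 1 = n + 1 := by omega
        have hne : n + 1 ≠ n - 2 := by omega
        simp [h1, hne, hy]
    · intro hd a b c d hab hbc hcd i
      refine h.disj_iff.1 hd a d ?_ i
      obtain ⟨hn, e, he⟩ := h
      obtain ⟨a, rfl⟩ := e.surjective a
      obtain ⟨b, rfl⟩ := e.surjective b
      obtain ⟨c, rfl⟩ := e.surjective c
      obtain ⟨d, rfl⟩ := e.surjective d
      rw [e.map_adj_iff, SimpleGraph.pathGraph_adj] at hab hbc hcd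
      -- A walk of length 3 on a path changes the parity of the position, so it cannot be closed.
      intro had
      have := congrArg Fin.val (e.injective had)
      omega
  ext I
  constructor
  · rintro ⟨hI, n, x, y, h⟩
    exact ⟨n, x, y, h, (key h).1 hI⟩
  · rintro ⟨n, x, y, h, hd⟩
    exact ⟨(key h).2 hd, n, x, y, h⟩

/-- A message that encodes the outcome of a round. -/
def encodeReception (r : Reception) : List Bool := List.replicate (Encodable.encode r) true

/-- LOCAL messages have no length bound, so a unary code is permitted; injectivity lets the receiver
recover the reception. -/
theorem encodeReception_injective : Function.Injective encodeReception := fun r s h =>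
  Encodable.encode_injective (by simpa [encodeReception] using congrArg List.length h)

open Classical in
/-- Every node sends its label, and then all that it has received, to its neighbors.  It rejects if
the label of a neighbor clashes with that of a neighbor of a neighbor. -/
noncomputable def walkAlgorithm : Algorithm where
  send inp hist _ := match hist with
    | [] => inp.label
    | r :: _ => encodeReception r
  bcast _ _ := []
  output _ hist := match hist with
    | [r, s] => decide (∀ p ∈ r, ∀ q ∈ s, ∀ r', encodeReception r' = q.2 → ∀ p' ∈ r', ∀ i : ℕ,
        ¬ (p.2[i]? = some true ∧ p'.2[i]? = some true))
    | _ => true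

theorem disjointOnWalks_mem_hybridClass (N : ℕ → ℕ) :
    disjointOnWalks ∈ hybridClass N [.LOCAL, .LOCAL] := by
  classical
  refine ⟨walkAlgorithm, 0, ?_, ?_⟩
  · intro inp hist
    have h : ∀ k, [RoundKind.LOCAL, .LOCAL][hist.length]? = some k → k = .LOCAL := by
      intro k hk
      have := List.mem_of_getElem? hk
      simpa using this
    exact ⟨fun h' => absurd (h _ h') (by simp), fun h' => absurd (h _ h') (by simp)⟩
  · intro I id _
    set r₁ : Fin I.n → Reception := fun v =>
      (Finset.univ.filter fun w => I.graph.Adj v w).image fun w => (id w, I.label w) with hr₁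
    set r₂ : Fin I.n → Reception := fun v =>
      (Finset.univ.filter fun w => I.graph.Adj v w).image
        fun w => (id w, encodeReception (r₁ w)) with hr₂
    have hacc : AllAccept walkAlgorithm [.LOCAL, .LOCAL] I id ↔ ∀ v, ∀ p ∈ r₁ v, ∀ q ∈ r₂ v, ∀ r',
        encodeReception r' = q.2 → ∀ p' ∈ r', ∀ i : ℕ,
        ¬ (p.2[i]? = some true ∧ p'.2[i]? = some true) := by
      refine forall_congr' fun v => ?_
      have hrun : run walkAlgorithm [.LOCAL, .LOCAL] I id v = [r₁ v, r₂ v] := by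
        simp only [run, List.foldl, List.nil_append, List.singleton_append, hr₁, hr₂]
        unfold received
        simp only [walkAlgorithm, nodeInput]
      rw [hrun]
      simp only [walkAlgorithm, decide_eq_true_eq]
    rw [hacc]
    constructor
    · intro h a b c d hab hbc hcd i
      have hmem₁ : ∀ {v w}, I.graph.Adj v w → (id w, I.label w) ∈ r₁ v := fun h =>
        Finset.mem_image_of_mem (fun w => (id w, I.label w)) (by simpa using h)
      have hmem₂ : (id c, encodeReception (r₁ c)) ∈ r₂ b :=
        Finset.mem_image_of_mem (fun w => (id w, encodeReception (r₁ w))) (by simpa using hbc)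
      -- The second vertex `b` detects the clash: it hears the label of `a` directly, and that of
      -- `d` in the report of `c`.
      exact h b _ (hmem₁ hab.symm) _ hmem₂ (r₁ c) rfl _ (hmem₁ hcd) i
    · intro h b p hp q hq r' hr' p' hp' i
      simp only [hr₁, hr₂, Finset.mem_image, Finset.mem_filter, Finset.mem_univ, true_and] at hp hq
      obtain ⟨a, hab, rfl⟩ := hp
      obtain ⟨c, hbc, rfl⟩ := hq
      obtain rfl := encodeReception_injective hr'
      simp only [Finset.mem_image, Finset.mem_filter, Finset.mem_univ, true_and] at hp'
      obtain ⟨d, hcd, rfl⟩ := hp'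
      exact h a b c d hab.symm hbc hcd i

end HybridModels

theorem mainTheorem8 (N : ℕ → ℕ) (hN : ∀ n, n ≤ N n) (hpoly : ∃ k : ℕ, ∀ n, N n ≤ n ^ k + k) :
    (∃ 𝓛 : HybridModels.DistLanguage,
      𝓛 ∩ HybridModels.disjPaths = HybridModels.disjointnessOnPath ∧
      𝓛 ∈ HybridModels.hybridClass N [.LOCAL, .LOCAL] \
        (HybridModels.hybridClass N [.BCC, .BCC] ∪
          HybridModels.hybridClass N [.LOCAL, .BCC] ∪
          HybridModels.hybridClass N [.CONGEST, .CONGEST])) ∧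
    (∀ 𝓛 : HybridModels.DistLanguage,
      𝓛 ∩ HybridModels.disjPaths = HybridModels.disjointnessOnPath →
      ∀ ε : ℝ, 0 < ε →
        𝓛 ∉ HybridModels.randHybridClass N [.BCC, .BCC] (1 / 2 - ε) ∪
          HybridModels.randHybridClass N [.LOCAL, .BCC] (1 / 2 - ε) ∪
          HybridModels.randHybridClass N [.CONGEST, .CONGEST] (1 / 2 - ε)) := by
  have lower : ∀ 𝓛 : HybridModels.DistLanguage,
      𝓛 ∩ HybridModels.disjPaths = HybridModels.disjointnessOnPath → ∀ ε : ℝ, 0 < ε →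
        𝓛 ∉ HybridModels.randHybridClass N [.BCC, .BCC] (1 / 2 - ε) ∪
          HybridModels.randHybridClass N [.LOCAL, .BCC] (1 / 2 - ε) ∪
          HybridModels.randHybridClass N [.CONGEST, .CONGEST] (1 / 2 - ε) := by
    rintro 𝓛 h𝓛 ε hε ((h | h) | h)
    · exact HybridModels.notMem_randHybridClass hN h𝓛
        HybridModels.exists_transcript_BCC_BCC hε h
    · exact HybridModels.notMem_randHybridClass hN h𝓛
        HybridModels.exists_transcript_LOCAL_BCC hε h
    · exact HybridModels.notMem_randHybridClass hN h𝓛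
        HybridModels.exists_transcript_CONGEST_CONGEST hε h
  refine ⟨⟨HybridModels.disjointOnWalks, HybridModels.disjointOnWalks_inter_disjPaths,
    HybridModels.disjointOnWalks_mem_hybridClass N, fun h => ?_⟩, lower⟩
  have hsub := fun rs => HybridModels.hybridClass_subset_randHybridClass N rs
    (show (0 : ℝ) ≤ 1 / 2 - 1 / 4 by norm_num)
  exact lower _ HybridModels.disjointOnWalks_inter_disjPaths (1 / 4) (by norm_num)
    (Set.union_subset_union (Set.union_subset_union (hsub _) (hsub _)) (hsub _) h)
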